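/- For $s,m\in\mathbb N$ and an interval $I\subset\mathbb R$, let $H^{s,m}(I)$ be the space of all $f\in H^s(I)$ such that $$|f|_{H^{s,m}(I)}^2:=\sum_{\alpha=0}^{s}\int_I(1+z^2)^m\,|f^{(\alpha)}(z)|^2\,dz<+\infty ,$$ where $f^{(\alpha)}$ denotes the weak derivative of order $\alpha$. **Lemma.** Let $T>0$, $s,n\in\mathbb N$ (with $0\in\mathbb N$), and let $h\in C^\infty(\mathbb R,\mathbb R)$ be such that $$\operatorname{supp}h\subset(0,T/3]\cup[2T/3,T)\qquad\text{and}\qquad\int_0^T t^k h(t)\,dt=0\quad\text{for all integers }0\le k<n .$$ Let $V=V(t,z)$ be the solution to $$\partial_tV-\partial_{zz}V=0\ \text{ for } t,z>0,\qquad V(t,0)=h(t)\ \text{ for } t\ge0,\qquad V(0,z)=0\ \text{ for } z\ge0,$$ that is, the unique classical solution that is continuous on $[0,\infty)\times[0,\infty)$ and bounded on $[0,\tau]\times[0,\infty)$ for every $\tau>0$ (such a solution exists and is unique). Then, for every integer $m$ with $0\le m\le 2n+1$, there exists a constant $C$ such that, for all $t\ge0$, one has $V(t,\cdot)\in H^{s,m}(\mathbb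 R_+)$ and $$|V(t,\cdot)|_{H^{s,m}(\mathbb R_+)}\le C\left|\frac{\ln(2+t)}{2+t}\right|^{\frac14+\frac{2n+1}{2}-\frac m2}.$$ -/

import Mathlib

open scoped ContDiff

namespace BoundaryLayer

/-- `g` is a weak derivative of order `α` of `f` on (the interior of) the interval `I ⊆ ℝ`. -/
structure HasWeakDeriv (I : Set ℝ) (α : ℕ) (f g : ℝ → ℝ) : Prop where
  locInt_left : MeasureTheory.LocallyIntegrableOn f (interior I)
  locInt_right : MeasureTheory.LocallyIntegrableOn g (interior I)
  integral_eq : ∀ φ : ℝ → ℝ, ContDiff ℝ ∞ φ → HasCompactSupport φ → tsupport φ ⊆ interior I →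
    ∫ z in interior I, f z * iteratedDeriv α φ z = (-1 : ℝ) ^ α * ∫ z in interior I, g z * φ z

open Classical in
/-- The weak derivative of order `α` of `f` on `I` (unique almost everywhere on the interior of `I`);
the value is `0` if there is none. -/
noncomputable def weakDeriv (I : Set ℝ) (α : ℕ) (f : ℝ → ℝ) : ℝ → ℝ :=
  if h : ∃ g, HasWeakDeriv I α f g then h.choose else 0

/-- Membership in the Sobolev space `H^s(I)`: all weak derivatives up to order `s` exist and are
square integrable. -/
def MemSobolev (I : Set ℝ) (s : ℕ) (f : ℝ → ℝ) : Prop :=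
  ∀ α ≤ s, ∃ g, HasWeakDeriv I α f g ∧ MeasureTheory.MemLp g 2 (MeasureTheory.volume.restrict I)

/-- Membership in the weighted Sobolev space `H^{s,m}(I)`. -/
def MemWeightedSobolev (I : Set ℝ) (s m : ℕ) (f : ℝ → ℝ) : Prop :=
  MemSobolev I s f ∧
    ∀ α ≤ s, MeasureTheory.IntegrableOn (fun z => (1 + z ^ 2) ^ m * (weakDeriv I α f z) ^ 2) I

/-- The natural norm of `H^{s,m}(I)`. -/
noncomputable def weightedSobolevNorm (I : Set ℝ) (s m : ℕ) (f : ℝ → ℝ) : ℝ :=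
  Real.sqrt (∑ α ∈ Finset.range (s + 1), ∫ z in I, (1 + z ^ 2) ^ m * (weakDeriv I α f z) ^ 2)

/-- `V` is a classical solution, bounded on `[0, τ] × [0, ∞)` for every `τ`, of the heat equation on
the half-line `z > 0` with boundary value `h` at `z = 0` and initial value `0`.  Only the values
`V t z` with `t ≥ 0` and `z ≥ 0` matter. -/
structure IsHalfLineHeatSolution (h : ℝ → ℝ) (V : ℝ → ℝ → ℝ) : Prop where
  continuousOn : ContinuousOn (fun p : ℝ × ℝ => V p.1 p.2) (Set.Ici 0 ×ˢ Set.Ici 0)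
  bounded : ∀ τ : ℝ, ∃ M : ℝ, ∀ t ∈ Set.Icc 0 τ, ∀ z ≥ 0, |V t z| ≤ M
  differentiable_time : ∀ t > 0, ∀ z > 0, DifferentiableAt ℝ (fun r => V r z) t
  differentiable_space : ∀ t > 0, ∀ z > 0, DifferentiableAt ℝ (V t) z
  differentiable_space_two : ∀ t > 0, ∀ z > 0, DifferentiableAt ℝ (deriv (V t)) z
  heat : ∀ t > 0, ∀ z > 0, deriv (fun r => V r z) t - deriv (deriv (V t)) z = 0
  boundary : ∀ t ≥ 0, V t 0 = h t
  initial : ∀ z ≥ 0, V 0 z = 0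

end BoundaryLayer

namespace BoundaryLayer

open MeasureTheory Set Filter Topology

/-- The `j`-th derivative in `z` of the heat kernel `exp (-z² / (4σ)) / √(4πσ)`. -/
noncomputable def heatKernelDeriv : ℕ → ℝ → ℝ → ℝ
  | 0, σ, z => Real.exp (-(z ^ 2 / (4 * σ))) / Real.sqrt (4 * Real.pi * σ)
  | 1, σ, z => -(z / (2 * σ)) * (Real.exp (-(z ^ 2 / (4 * σ))) / Real.sqrt (4 * Real.pi * σ))
  | j + 2, σ, z => -(z / (2 * σ)) * heatKernelDeriv (j + 1) σ z
      - ((j + 1 : ℝ) / (2 * σ)) * heatKernelDeriv j σ z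

theorem heatKernelDeriv_one (σ z : ℝ) :
    heatKernelDeriv 1 σ z = -(z / (2 * σ)) * heatKernelDeriv 0 σ z := rfl

theorem heatKernelDeriv_add_two (j : ℕ) (σ z : ℝ) :
    heatKernelDeriv (j + 2) σ z = -(z / (2 * σ)) * heatKernelDeriv (j + 1) σ z
      - ((j + 1 : ℝ) / (2 * σ)) * heatKernelDeriv j σ z := rfl

theorem hasDerivAt_heatKernelDeriv_zero_space {σ : ℝ} (hσ : 0 < σ) (z : ℝ) :
    HasDerivAt (fun x => heatKernelDeriv 0 σ x) (heatKernelDeriv 1 σ z) z := by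
  have h0 : HasDerivAt (fun x : ℝ => -(x ^ 2 / (4 * σ))) (-(2 * z / (4 * σ))) z := by
    simpa using ((hasDerivAt_pow 2 z).div_const (4 * σ)).fun_neg
  refine (h0.exp.div_const (Real.sqrt (4 * Real.pi * σ))).congr_deriv ?_
  simp only [heatKernelDeriv]
  field_simp
  ring

theorem hasDerivAt_heatKernelDeriv_space {σ : ℝ} (hσ : 0 < σ) (j : ℕ) (z : ℝ) :
    HasDerivAt (fun x => heatKernelDeriv j σ x) (heatKernelDeriv (j + 1) σ z) z := by
  induction j using Nat.twoStepInduction with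
  | zero => exact hasDerivAt_heatKernelDeriv_zero_space hσ z
  | one =>
    have h0 := hasDerivAt_heatKernelDeriv_zero_space hσ z
    have h := (((hasDerivAt_id z).div_const (2 * σ)).neg).mul h0
    refine h.congr_deriv ?_
    rw [heatKernelDeriv_add_two]
    simp only [id, Pi.neg_apply, CharP.cast_eq_zero]
    ring
  | more j h0 h1 =>
    have h := ((((hasDerivAt_id z).div_const (2 * σ)).neg).mul h1).sub
      (h0.const_mul ((j + 1 : ℝ) / (2 * σ)))
    refine h.congr_deriv ?_
    rw [heatKernelDeriv_add_two (j + 1)]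
    simp only [id, Pi.neg_apply]
    push_cast
    ring

theorem hasDerivAt_heatKernelDeriv_zero_time {σ : ℝ} (hσ : 0 < σ) (z : ℝ) :
    HasDerivAt (fun x => heatKernelDeriv 0 x z) (heatKernelDeriv 2 σ z) σ := by
  have hp : 0 < 4 * Real.pi * σ := by positivity
  have h1 : HasDerivAt (fun x : ℝ => -(z ^ 2 / (4 * x))) (z ^ 2 / (4 * σ ^ 2)) σ := by
    have := (((hasDerivAt_id σ).const_mul (4 : ℝ)).inv (by simp [hσ.ne'])).const_mul (-(z ^ 2))
    refine (this.congr_deriv ?_).congr_of_eventuallyEq (Eventually.of_forall fun x => ?_)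
    · simp only [id]; field_simp
    · simp only [id, Pi.inv_apply]; ring
  have h2 : HasDerivAt (fun x : ℝ => Real.sqrt (4 * Real.pi * x))
      (4 * Real.pi / (2 * Real.sqrt (4 * Real.pi * σ))) σ := by
    have := ((hasDerivAt_id σ).const_mul (4 * Real.pi)).sqrt hp.ne'
    refine this.congr_deriv ?_
    simp
  have h := h1.exp.div h2 (Real.sqrt_pos.2 hp).ne'
  refine h.congr_deriv ?_
  rw [heatKernelDeriv_add_two]
  simp only [heatKernelDeriv, CharP.cast_eq_zero]
  have hs : Real.sqrt (4 * Real.pi * σ) ^ 2 = 4 * Real.pi * σ := Real.sq_sqrt hp.le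
  have hs0 : Real.sqrt (4 * Real.pi * σ) ≠ 0 := (Real.sqrt_pos.2 hp).ne'
  generalize Real.sqrt (4 * Real.pi * σ) = r at hs hs0 ⊢
  have : Real.pi = r ^ 2 / (4 * σ) := by field_simp; linarith
  rw [this]
  field_simp
  ring

theorem hasDerivAt_heatKernelDeriv_time {σ : ℝ} (hσ : 0 < σ) (j : ℕ) (z : ℝ) :
    HasDerivAt (fun x => heatKernelDeriv j x z) (heatKernelDeriv (j + 2) σ z) σ := by
  have hc : ∀ c : ℝ, HasDerivAt (fun x : ℝ => c / (2 * x)) (-(c / (2 * σ ^ 2))) σ := fun c => by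
    have := (((hasDerivAt_id σ).const_mul (2 : ℝ)).inv (by simp [hσ.ne'])).const_mul c
    refine (this.congr_deriv ?_).congr_of_eventuallyEq (Eventually.of_forall fun x => ?_)
    · simp only [id]; field_simp
    · simp only [id, Pi.inv_apply]; ring
  induction j using Nat.twoStepInduction with
  | zero => exact hasDerivAt_heatKernelDeriv_zero_time hσ z
  | one =>
    have h := ((hc z).neg).mul (hasDerivAt_heatKernelDeriv_zero_time hσ z)
    refine h.congr_deriv ?_
    rw [heatKernelDeriv_add_two 1, heatKernelDeriv_one]
    simp only [Pi.neg_apply]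
    push_cast
    field_simp
    ring
  | more j h0 h1 =>
    have h := (((hc z).neg).mul h1).sub ((hc (j + 1 : ℝ)).mul h0)
    refine h.congr_deriv ?_
    rw [heatKernelDeriv_add_two (j + 2), heatKernelDeriv_add_two j]
    simp only [Pi.neg_apply]
    push_cast
    field_simp
    ring

theorem exists_heatKernelDeriv_le_polynomial (j : ℕ) : ∃ A : ℝ, 0 ≤ A ∧ ∀ r > 0, ∀ z : ℝ,
    |heatKernelDeriv j (r ^ 2) z| * r ^ (j + 1) ≤
      A * (1 + |z| / r) ^ j * Real.exp (-(z ^ 2 / (4 * r ^ 2))) := by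
  have hzero : ∀ r > 0, ∀ z : ℝ, |heatKernelDeriv 0 (r ^ 2) z| * r =
      (Real.sqrt (4 * Real.pi))⁻¹ * Real.exp (-(z ^ 2 / (4 * r ^ 2))) := fun r hr z => by
    simp only [heatKernelDeriv]
    rw [Real.sqrt_mul (by positivity), Real.sqrt_sq hr.le, abs_of_pos (by positivity)]
    field_simp
  induction j using Nat.twoStepInduction with
  | zero =>
    refine ⟨(Real.sqrt (4 * Real.pi))⁻¹, by positivity, fun r hr z => ?_⟩
    simp [hzero r hr z]
  | one =>
    refine ⟨(Real.sqrt (4 * Real.pi))⁻¹, by positivity, fun r hr z => ?_⟩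
    have : |heatKernelDeriv 1 (r ^ 2) z| * r ^ (1 + 1) =
        (|z| / r) / 2 * (|heatKernelDeriv 0 (r ^ 2) z| * r) := by
      rw [heatKernelDeriv_one, abs_mul, abs_neg, abs_div, abs_of_pos (by positivity : 0 < 2 * r ^ 2)]
      field_simp
      ring
    rw [this, hzero r hr z]
    have hy : 0 ≤ |z| / r := by positivity
    have : 0 ≤ (Real.sqrt (4 * Real.pi))⁻¹ * Real.exp (-(z ^ 2 / (4 * r ^ 2))) := by positivity
    nlinarith
  | more j h0 h1 =>
    obtain ⟨A, hA, h0⟩ := h0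
    obtain ⟨B, hB, h1⟩ := h1
    refine ⟨B + (j + 1) * A, by positivity, fun r hr z => ?_⟩
    have h0 := h0 r hr z
    have h1 := h1 r hr z
    have hy : 0 ≤ |z| / r := by positivity
    have key : |heatKernelDeriv (j + 2) (r ^ 2) z| * r ^ (j + 2 + 1) ≤
        (|z| / r) / 2 * (|heatKernelDeriv (j + 1) (r ^ 2) z| * r ^ (j + 1 + 1)) +
        (j + 1) / 2 * (|heatKernelDeriv j (r ^ 2) z| * r ^ (j + 1)) := by
      rw [heatKernelDeriv_add_two]
      have := abs_sub (-(z / (2 * r ^ 2)) * heatKernelDeriv (j + 1) (r ^ 2) z)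
        (((j + 1 : ℝ) / (2 * r ^ 2)) * heatKernelDeriv j (r ^ 2) z)
      refine (mul_le_mul_of_nonneg_right this (by positivity)).trans_eq ?_
      rw [abs_mul, abs_neg, abs_div, abs_mul ((j + 1 : ℝ) / (2 * r ^ 2)), abs_div (j + 1 : ℝ),
        abs_of_pos (by positivity : 0 < 2 * r ^ 2), abs_of_pos (by positivity : (0 : ℝ) < j + 1)]
      field_simp
      ring
    refine key.trans ?_
    generalize |z| / r = y at *
    set E := Real.exp (-(z ^ 2 / (4 * r ^ 2)))
    have hE : 0 < E := Real.exp_pos _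
    calc y / 2 * (|heatKernelDeriv (j + 1) (r ^ 2) z| * r ^ (j + 1 + 1)) +
        (j + 1) / 2 * (|heatKernelDeriv j (r ^ 2) z| * r ^ (j + 1))
        ≤ (1 + y) * (B * (1 + y) ^ (j + 1) * E) + (j + 1) * (A * (1 + y) ^ (j + 2) * E) := by
          have h2 : A * (1 + y) ^ j * E ≤ A * (1 + y) ^ (j + 2) * E := by
            gcongr
            · linarith
            · omega
          have h3 := h0.trans h2
          refine add_le_add (mul_le_mul (by linarith) h1 (by positivity) (by positivity))
            (mul_le_mul (by linarith) h3 (by positivity) (by positivity))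
      _ = (B + (j + 1) * A) * (1 + y) ^ (j + 2) * E := by ring

theorem exists_pow_mul_exp_neg_sq_le (k : ℕ) {c : ℝ} (hc : 0 < c) : ∃ C : ℝ, 0 ≤ C ∧
    ∀ y : ℝ, 0 ≤ y → (1 + y) ^ k * Real.exp (-(c * y ^ 2)) ≤ C := by
  have hcont : Continuous fun y : ℝ => (1 + y) ^ k * Real.exp (-(c * y)) := by fun_prop
  have hlim : Tendsto (fun y : ℝ => (1 + y) ^ k * Real.exp (-(c * y))) atTop (𝓝 0) := by
    have h := (Real.tendsto_pow_mul_exp_neg_atTop_nhds_zero k).comp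
      ((tendsto_atTop_add_const_left atTop (1 : ℝ) tendsto_id).const_mul_atTop hc)
    have h2 := h.const_mul (Real.exp c / c ^ k)
    rw [mul_zero] at h2
    refine h2.congr fun y => ?_
    simp only [Function.comp, id, mul_pow]
    rw [show -(c * (1 + y)) = -c + -(c * y) by ring, Real.exp_add, Real.exp_neg c]
    field_simp
  obtain ⟨Y, hY⟩ := eventually_atTop.1 (hlim.eventually (ge_mem_nhds (zero_lt_one)))
  obtain ⟨M, hM⟩ := (isCompact_Icc (a := (0 : ℝ)) (b := Y)).bddAbove_image hcont.continuousOn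
  have hb : ∀ y : ℝ, 0 ≤ y → (1 + y) ^ k * Real.exp (-(c * y)) ≤ max M 1 := fun y hy => by
    rcases le_total y Y with h | h
    · exact le_max_of_le_left (hM ⟨y, ⟨hy, h⟩, rfl⟩)
    · exact le_max_of_le_right (hY y h)
  refine ⟨max (max M 1) (2 ^ k), by positivity, fun y hy => ?_⟩
  rcases le_total 1 y with h | h
  · refine le_max_of_le_left (le_trans ?_ (hb y hy))
    gcongr
    nlinarith
  · refine le_max_of_le_right ?_
    calc (1 + y) ^ k * Real.exp (-(c * y ^ 2)) ≤ 2 ^ k * 1 := by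
          gcongr
          · linarith
          · exact Real.exp_le_one_iff.2 (by have : 0 ≤ c * y ^ 2 := by positivity
                                            linarith)
      _ = 2 ^ k := mul_one _

theorem exists_heatKernelDeriv_le_gaussian (j : ℕ) : ∃ C : ℝ, 0 ≤ C ∧ ∀ σ > 0, ∀ z : ℝ,
    |heatKernelDeriv j σ z| ≤ C / Real.sqrt σ ^ (j + 1) * Real.exp (-(z ^ 2 / (8 * σ))) := by
  obtain ⟨A, hA, hj⟩ := exists_heatKernelDeriv_le_polynomial j
  obtain ⟨C, hC, hC'⟩ := exists_pow_mul_exp_neg_sq_le j (c := 1 / 8) (by norm_num)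
  refine ⟨A * C, by positivity, fun σ hσ z => ?_⟩
  have hr : 0 < Real.sqrt σ := Real.sqrt_pos.2 hσ
  have hs := Real.sq_sqrt hσ.le
  have h1 := hj _ hr z
  have h2 := hC' (|z| / Real.sqrt σ) (by positivity)
  rw [div_mul_eq_mul_div, le_div_iff₀ (by positivity)]
  rw [div_pow, sq_abs, hs] at h2
  rw [hs] at h1
  refine h1.trans ?_
  have : Real.exp (-(z ^ 2 / (4 * σ))) =
      Real.exp (-(1 / 8 * (z ^ 2 / σ))) * Real.exp (-(z ^ 2 / (8 * σ))) := by
    rw [← Real.exp_add]; congr 1; field_simp; ring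
  rw [this]
  calc _ = A * ((1 + |z| / Real.sqrt σ) ^ j * Real.exp (-(1 / 8 * (z ^ 2 / σ)))) *
        Real.exp (-(z ^ 2 / (8 * σ))) := by ring
    _ ≤ _ := by gcongr

theorem exists_heatKernelDeriv_le_of_pos (j : ℕ) : ∃ B : ℝ, 0 ≤ B ∧ ∀ σ > 0, ∀ z > 0,
    |heatKernelDeriv j σ z| ≤ B * σ / z ^ (j + 3) := by
  obtain ⟨A, hA, hj⟩ := exists_heatKernelDeriv_le_gaussian j
  obtain ⟨C, hC, hC'⟩ := exists_pow_mul_exp_neg_sq_le (j + 3) (c := 1 / 8) (by norm_num)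
  refine ⟨A * C, by positivity, fun σ hσ z hz => (hj σ hσ z).trans ?_⟩
  have hr : 0 < Real.sqrt σ := Real.sqrt_pos.2 hσ
  have hs := Real.sq_sqrt hσ.le
  have h2 := hC' (z / Real.sqrt σ) (by positivity)
  have h3 : (z / Real.sqrt σ) ^ (j + 3) * Real.exp (-(z ^ 2 / (8 * σ))) ≤ C := by
    refine le_trans ?_ h2
    rw [div_pow _ _ 2, hs]
    have : 1 / 8 * (z ^ 2 / σ) = z ^ 2 / (8 * σ) := by field_simp
    rw [this]
    gcongr
    linarith
  calc A / Real.sqrt σ ^ (j + 1) * Real.exp (-(z ^ 2 / (8 * σ)))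
      = A * ((z / Real.sqrt σ) ^ (j + 3) * Real.exp (-(z ^ 2 / (8 * σ)))) *
        Real.sqrt σ ^ 2 / z ^ (j + 3) := by rw [div_pow]; field_simp; ring
    _ ≤ A * C * σ / z ^ (j + 3) := by rw [hs]; gcongr

theorem continuousOn_heatKernelDeriv_time (j : ℕ) (z : ℝ) :
    ContinuousOn (fun σ => heatKernelDeriv j σ z) (Ioi 0) := fun _ hσ =>
  (hasDerivAt_heatKernelDeriv_time hσ j z).continuousAt.continuousWithinAt

/-- Smooth functions supported in `[0, T]`. -/
structure IsBoundaryDatum (T : ℝ) (g : ℝ → ℝ) : Prop where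
  contDiff : ContDiff ℝ ∞ g
  tsupport_subset : tsupport g ⊆ Icc 0 T

namespace IsBoundaryDatum

variable {T : ℝ} {g : ℝ → ℝ}

theorem hasCompactSupport (hg : IsBoundaryDatum T g) : HasCompactSupport g :=
  isCompact_Icc.of_isClosed_subset (isClosed_tsupport g) hg.tsupport_subset

theorem continuous (hg : IsBoundaryDatum T g) : Continuous g := hg.contDiff.continuous

theorem hasDerivAt (hg : IsBoundaryDatum T g) (x : ℝ) : HasDerivAt g (deriv g x) x :=
  (hg.contDiff.differentiable (by simp) x).hasDerivAt

theorem deriv (hg : IsBoundaryDatum T g) : IsBoundaryDatum T (deriv g) where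
  contDiff := ((contDiff_infty_iff_deriv (𝕜 := ℝ)).1 hg.contDiff).2
  tsupport_subset := (closure_minimal support_deriv_subset (isClosed_tsupport g)).trans
    hg.tsupport_subset

theorem iteratedDeriv (hg : IsBoundaryDatum T g) (k : ℕ) :
    IsBoundaryDatum T (iteratedDeriv k g) := by
  induction k with
  | zero => simpa using hg
  | succ k ih => rw [iteratedDeriv_succ]; exact ih.deriv

theorem eq_zero (hg : IsBoundaryDatum T g) {x : ℝ} (hx : x ∉ Icc 0 T) : g x = 0 :=
  image_eq_zero_of_notMem_tsupport fun h => hx (hg.tsupport_subset h)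

theorem eq_zero_of_nonpos (hg : IsBoundaryDatum T g) {x : ℝ} (hx : x ≤ 0) : g x = 0 := by
  have hcl : IsClosed {x | g x = 0} := isClosed_eq hg.continuous continuous_const
  have hsub : Iio (0 : ℝ) ⊆ {x | g x = 0} := fun y hy => hg.eq_zero fun h => not_le.2 hy h.1
  have := closure_minimal hsub hcl
  rw [closure_Iio] at this
  exact this hx

theorem exists_abs_le (hg : IsBoundaryDatum T g) : ∃ M : ℝ, 0 ≤ M ∧ ∀ x, |g x| ≤ M := by
  obtain ⟨M, hM⟩ := hg.hasCompactSupport.exists_bound_of_continuous hg.continuous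
  exact ⟨M, (norm_nonneg _).trans (hM 0), hM⟩

theorem integrable_comp_mul (hg : IsBoundaryDatum T g) (t : ℝ) {f : ℝ → ℝ} (hf : Continuous f) :
    Integrable fun σ => g (t - σ) * f σ := by
  have hc : Continuous fun σ => g (t - σ) * f σ :=
    (hg.continuous.comp (continuous_const.sub continuous_id)).mul hf
  refine hc.integrable_of_hasCompactSupport ?_
  refine HasCompactSupport.intro (isCompact_Icc (a := t - T) (b := t)) fun x hx => ?_
  rw [hg.eq_zero, zero_mul]
  exact fun h => hx ⟨by linarith [h.2], by linarith [h.1]⟩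

end IsBoundaryDatum

/-- The heat potential of density `g`, differentiated `j` times in `z`. -/
noncomputable def heatPotential (j : ℕ) (g : ℝ → ℝ) (t z : ℝ) : ℝ :=
  ∫ σ in Ioi (0 : ℝ), g (t - σ) * heatKernelDeriv j σ z

variable {T : ℝ} {g : ℝ → ℝ}

theorem aestronglyMeasurable_heatPotential (hg : Continuous g) (j : ℕ) (t z : ℝ) :
    AEStronglyMeasurable (fun σ => g (t - σ) * heatKernelDeriv j σ z)
      (volume.restrict (Ioi (0 : ℝ))) :=
  ContinuousOn.aestronglyMeasurable ((hg.comp (continuous_const.sub continuous_id)).continuousOn.mul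
    (continuousOn_heatKernelDeriv_time j z)) measurableSet_Ioi

theorem integrableOn_heatPotential (hg : IsBoundaryDatum T g) (j : ℕ) (t : ℝ) {z : ℝ}
    (hz : 0 < z) : IntegrableOn (fun σ => g (t - σ) * heatKernelDeriv j σ z) (Ioi 0) := by
  obtain ⟨B, hB, hj⟩ := exists_heatKernelDeriv_le_of_pos j
  have hint := (hg.integrable_comp_mul t
    (f := fun σ => B * σ / z ^ (j + 3)) (by fun_prop)).norm.integrableOn (s := Ioi (0 : ℝ))
  refine hint.mono' (aestronglyMeasurable_heatPotential hg.continuous j t z) ?_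
  filter_upwards [ae_restrict_mem measurableSet_Ioi] with σ hσ
  rw [norm_mul, norm_mul]
  refine mul_le_mul_of_nonneg_left ?_ (norm_nonneg _)
  exact (hj σ hσ z hz).trans (le_abs_self _)

theorem hasDerivAt_heatPotential (hg : IsBoundaryDatum T g) (j : ℕ) (t : ℝ) {z : ℝ}
    (hz : 0 < z) : HasDerivAt (heatPotential j g t) (heatPotential (j + 1) g t z) z := by
  obtain ⟨B, hB, hj⟩ := exists_heatKernelDeriv_le_of_pos (j + 1)
  have hint := (hg.integrable_comp_mul t
    (f := fun σ => B * σ / (z / 2) ^ (j + 1 + 3)) (by fun_prop)).norm.integrableOn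
      (s := Ioi (0 : ℝ))
  refine (hasDerivAt_integral_of_dominated_loc_of_deriv_le
    (F := fun x σ => g (t - σ) * heatKernelDeriv j σ x)
    (F' := fun x σ => g (t - σ) * heatKernelDeriv (j + 1) σ x)
    (s := Ioi (z / 2)) (Ioi_mem_nhds (by linarith)) ?_ ?_ ?_ ?_ hint ?_).2
  · exact Eventually.of_forall fun x => aestronglyMeasurable_heatPotential hg.continuous j t x
  · exact integrableOn_heatPotential hg j t hz
  · exact aestronglyMeasurable_heatPotential hg.continuous (j + 1) t z
  · filter_upwards [ae_restrict_mem measurableSet_Ioi] with σ hσ x hx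
    have hσ : 0 < σ := hσ
    have hx : z / 2 < x := hx
    rw [norm_mul, norm_mul]
    refine mul_le_mul_of_nonneg_left ?_ (norm_nonneg _)
    refine ((hj σ hσ x (by linarith)).trans ?_).trans (le_abs_self _)
    gcongr
  · filter_upwards [ae_restrict_mem measurableSet_Ioi] with σ hσ x _
    exact (hasDerivAt_heatKernelDeriv_space hσ j x).const_mul _

theorem heatPotential_deriv (hg : IsBoundaryDatum T g) (j : ℕ) (t : ℝ) {z : ℝ} (hz : 0 < z) :
    heatPotential j (deriv g) t z = heatPotential (j + 2) g t z := by
  have hu : ∀ x ∈ Ioi (0 : ℝ), HasDerivAt (fun σ => g (t - σ)) (-deriv g (t - x)) x := fun x _ => 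
    (hg.hasDerivAt (t - x)).comp_const_sub t x
  have hv : ∀ x ∈ Ioi (0 : ℝ), HasDerivAt (fun σ => heatKernelDeriv j σ z)
      (heatKernelDeriv (j + 2) x z) x := fun x hx => hasDerivAt_heatKernelDeriv_time hx j z
  obtain ⟨M, hM0, hM⟩ := hg.exists_abs_le
  obtain ⟨B, hB, hj⟩ := exists_heatKernelDeriv_le_of_pos j
  have h0 : Tendsto ((fun σ => g (t - σ)) * fun σ => heatKernelDeriv j σ z) (𝓝[>] 0) (𝓝 0) := by
    have hlim : Tendsto (fun σ : ℝ => M * (B * σ / z ^ (j + 3))) (𝓝[>] 0) (𝓝 0) := by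
      have : Continuous fun σ : ℝ => M * (B * σ / z ^ (j + 3)) := by fun_prop
      simpa using (this.tendsto 0).mono_left nhdsWithin_le_nhds
    refine squeeze_zero_norm' ?_ hlim
    filter_upwards [self_mem_nhdsWithin] with σ hσ
    simp only [Pi.mul_apply, norm_mul]
    exact mul_le_mul (hM _) (hj σ hσ z hz) (norm_nonneg _) hM0
  have hinf : Tendsto ((fun σ => g (t - σ)) * fun σ => heatKernelDeriv j σ z) atTop (𝓝 0) := by
    refine tendsto_const_nhds.congr' ?_
    filter_upwards [eventually_gt_atTop t] with σ hσ
    simp [hg.eq_zero_of_nonpos (show t - σ ≤ 0 by linarith)]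
  have h := integral_Ioi_mul_deriv_eq_deriv_mul hu hv
    (integrableOn_heatPotential hg (j + 2) t hz) (by
      have := (integrableOn_heatPotential hg.deriv j t hz).neg
      refine this.congr (Eventually.of_forall fun x => ?_)
      simp) h0 hinf
  simp only [heatPotential]
  rw [h]
  simp [integral_neg]

theorem heatPotential_iteratedDeriv (hg : IsBoundaryDatum T g) (j k : ℕ) (t : ℝ) {z : ℝ}
    (hz : 0 < z) : heatPotential j (iteratedDeriv k g) t z = heatPotential (j + 2 * k) g t z := by
  induction k generalizing j with
  | zero => simp
  | succ k ih =>
    rw [iteratedDeriv_succ, heatPotential_deriv (hg.iteratedDeriv k) j t hz, ih]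
    congr 1
    ring

/-- The double layer potential, in self-similar variables; it solves the heat equation with
boundary value `h`. -/
noncomputable def boundaryHeatSolution (h : ℝ → ℝ) (t z : ℝ) : ℝ :=
  2 / Real.sqrt Real.pi *
    ∫ u in Ioi (0 : ℝ), h (t - z ^ 2 / (4 * u ^ 2)) * Real.exp (-u ^ 2)

theorem image_sq_div_Ioi {z : ℝ} (hz : 0 < z) :
    (fun u : ℝ => z ^ 2 / (4 * u ^ 2)) '' Ioi 0 = Ioi 0 := by
  ext σ
  constructor
  · rintro ⟨u, hu, rfl⟩
    have : 0 < u := hu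
    simp only [mem_Ioi]
    positivity
  · intro hσ
    have hσ : 0 < σ := hσ
    refine ⟨z / (2 * Real.sqrt σ), show 0 < z / (2 * Real.sqrt σ) by positivity, ?_⟩
    have := Real.sq_sqrt hσ.le
    simp only [div_pow, mul_pow, this]
    field_simp
    ring

theorem boundaryHeatSolution_eq (h : ℝ → ℝ) (t : ℝ) {z : ℝ} (hz : 0 < z) :
    boundaryHeatSolution h t z = -2 * heatPotential 1 h t z := by
  have hd : ∀ u ∈ Ioi (0 : ℝ), HasDerivWithinAt (fun u : ℝ => z ^ 2 / (4 * u ^ 2))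
      (-(z ^ 2 / (2 * u ^ 3))) (Ioi 0) u := fun u hu => by
    have hu : 0 < u := hu
    have h1 := ((((hasDerivAt_pow 2 u).const_mul (4 : ℝ)).fun_inv (by positivity)).const_mul (z ^ 2))
    refine HasDerivAt.hasDerivWithinAt ((h1.congr_deriv ?_).congr_of_eventuallyEq
      (Eventually.of_forall fun x => ?_))
    · field_simp; ring
    · simp only [div_eq_mul_inv]
  have hinj : InjOn (fun u : ℝ => z ^ 2 / (4 * u ^ 2)) (Ioi 0) := fun a ha b hb hab => by
    have ha : 0 < a := ha
    have hb : 0 < b := hb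
    simp only at hab
    have h2 : a ^ 2 = b ^ 2 := by
      field_simp at hab
      linarith
    exact (sq_eq_sq₀ ha.le hb.le).1 h2
  have hcv := integral_image_eq_integral_abs_deriv_smul measurableSet_Ioi hd hinj
    (fun σ => h (t - σ) * heatKernelDeriv 1 σ z)
  rw [image_sq_div_Ioi hz] at hcv
  rw [heatPotential, hcv, boundaryHeatSolution, ← integral_const_mul, ← integral_const_mul]
  refine setIntegral_congr_fun measurableSet_Ioi fun u hu => ?_
  have hu : 0 < u := hu
  have hpi := Real.pi_pos
  have hr : Real.sqrt (4 * Real.pi * (z ^ 2 / (4 * u ^ 2))) = Real.sqrt Real.pi * (z / u) := by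
    rw [show 4 * Real.pi * (z ^ 2 / (4 * u ^ 2)) = Real.pi * (z / u) ^ 2 by field_simp,
      Real.sqrt_mul hpi.le, Real.sqrt_sq (by positivity)]
  have he : z ^ 2 / (4 * (z ^ 2 / (4 * u ^ 2))) = u ^ 2 := by field_simp
  have hp : 0 < Real.sqrt Real.pi := Real.sqrt_pos.2 hpi
  simp only [heatKernelDeriv, smul_eq_mul, hr, he]
  rw [abs_neg, abs_of_pos (by positivity)]
  field_simp
  ring

theorem integrableOn_exp_neg_sq : IntegrableOn (fun u : ℝ => Real.exp (-u ^ 2)) (Ioi 0) := by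
  simpa using (integrable_exp_neg_mul_sq (b := 1) one_pos).integrableOn (s := Ioi (0 : ℝ))

theorem measurable_boundaryHeatSolution_integrand (hg : Continuous g) (t z : ℝ) :
    AEStronglyMeasurable (fun u : ℝ => g (t - z ^ 2 / (4 * u ^ 2)) * Real.exp (-u ^ 2))
      (volume.restrict (Ioi (0 : ℝ))) := by
  have := hg.measurable
  exact Measurable.aestronglyMeasurable (by fun_prop)

theorem continuous_boundaryHeatSolution (hg : IsBoundaryDatum T g) :
    Continuous fun p : ℝ × ℝ => boundaryHeatSolution g p.1 p.2 := by
  obtain ⟨M, hM0, hM⟩ := hg.exists_abs_le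
  refine continuous_const.mul (continuous_of_dominated
    (bound := fun u => M * Real.exp (-u ^ 2)) (fun p => ?_) (fun p => ?_) ?_ ?_)
  · exact measurable_boundaryHeatSolution_integrand hg.continuous p.1 p.2
  · filter_upwards with u
    rw [norm_mul, Real.norm_of_nonneg (Real.exp_pos _).le]
    exact mul_le_mul_of_nonneg_right (hM _) (Real.exp_pos _).le
  · exact integrableOn_exp_neg_sq.const_mul M
  · filter_upwards with u
    have := hg.continuous
    fun_prop

theorem hasDerivAt_boundaryHeatSolution_time (hg : IsBoundaryDatum T g) (t z : ℝ) :
    HasDerivAt (fun r => boundaryHeatSolution g r z) (boundaryHeatSolution (deriv g) t z) t := by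
  obtain ⟨M, hM0, hM⟩ := hg.exists_abs_le
  obtain ⟨M', hM'0, hM'⟩ := hg.deriv.exists_abs_le
  refine HasDerivAt.const_mul _ (hasDerivAt_integral_of_dominated_loc_of_deriv_le
    (F := fun r u => g (r - z ^ 2 / (4 * u ^ 2)) * Real.exp (-u ^ 2))
    (F' := fun r u => deriv g (r - z ^ 2 / (4 * u ^ 2)) * Real.exp (-u ^ 2))
    (bound := fun u => M' * Real.exp (-u ^ 2))
    (s := univ) univ_mem ?_ ?_ ?_ ?_ ?_ ?_).2
  · exact Eventually.of_forall fun x => measurable_boundaryHeatSolution_integrand hg.continuous x z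
  · refine (integrableOn_exp_neg_sq.const_mul M).mono'
      (measurable_boundaryHeatSolution_integrand hg.continuous t z) ?_
    filter_upwards with u
    rw [norm_mul, Real.norm_of_nonneg (Real.exp_pos _).le]
    exact mul_le_mul_of_nonneg_right (hM _) (Real.exp_pos _).le
  · exact measurable_boundaryHeatSolution_integrand hg.deriv.continuous t z
  · filter_upwards with u x _
    rw [norm_mul, Real.norm_of_nonneg (Real.exp_pos _).le]
    exact mul_le_mul_of_nonneg_right (hM' _) (Real.exp_pos _).le
  · exact integrableOn_exp_neg_sq.const_mul M'
  · filter_upwards with u x _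
    refine HasDerivAt.mul_const ?_ _
    exact (hg.hasDerivAt (x - z ^ 2 / (4 * u ^ 2))).comp_sub_const x _

theorem boundaryHeatSolution_zero_right (h : ℝ → ℝ) (t : ℝ) : boundaryHeatSolution h t 0 = h t := by
  have h1 : ∫ u in Ioi (0 : ℝ), Real.exp (-u ^ 2) = Real.sqrt Real.pi / 2 := by
    simpa using integral_gaussian_Ioi 1
  have hp : Real.sqrt Real.pi ≠ 0 := (Real.sqrt_pos.2 Real.pi_pos).ne'
  simp only [boundaryHeatSolution, ne_eq, OfNat.ofNat_ne_zero, not_false_eq_true, zero_pow,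
    zero_div, sub_zero, integral_const_mul, h1]
  field_simp

theorem boundaryHeatSolution_zero_left (hg : IsBoundaryDatum T g) (z : ℝ) :
    boundaryHeatSolution g 0 z = 0 := by
  have : ∀ u : ℝ, g (0 - z ^ 2 / (4 * u ^ 2)) = 0 := fun u =>
    hg.eq_zero_of_nonpos (by have : 0 ≤ z ^ 2 / (4 * u ^ 2) := by positivity
                             linarith)
  simp only [boundaryHeatSolution, this, zero_mul, integral_zero, mul_zero]

theorem exists_boundaryHeatSolution_le (hg : IsBoundaryDatum T g) : ∃ C : ℝ, 0 ≤ C ∧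
    ∀ t ≥ 0, ∀ z : ℝ, |boundaryHeatSolution g t z| ≤ C * Real.exp (-(z ^ 2 / (8 * (2 + t)))) := by
  obtain ⟨M, hM0, hM⟩ := hg.exists_abs_le
  have hint : IntegrableOn (fun u : ℝ => Real.exp (-(1 / 2) * u ^ 2)) (Ioi 0) :=
    (integrable_exp_neg_mul_sq (b := 1 / 2) (by norm_num)).integrableOn
  refine ⟨2 / Real.sqrt Real.pi * (M * ∫ u in Ioi (0 : ℝ), Real.exp (-(1 / 2) * u ^ 2)), ?_,
    fun t ht z => ?_⟩
  · have : 0 ≤ ∫ u in Ioi (0 : ℝ), Real.exp (-(1 / 2) * u ^ 2) :=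
      integral_nonneg fun u => (Real.exp_pos _).le
    positivity
  rw [boundaryHeatSolution, abs_mul, abs_of_nonneg (by positivity), mul_assoc]
  refine mul_le_mul_of_nonneg_left ?_ (by positivity)
  rw [mul_assoc, mul_comm (∫ u in Ioi (0 : ℝ), _), ← mul_assoc, ← integral_const_mul]
  rw [← Real.norm_eq_abs]
  refine norm_integral_le_of_norm_le (hint.const_mul _) ?_
  filter_upwards [ae_restrict_mem measurableSet_Ioi] with u hu
  have hu : 0 < u := hu
  rw [norm_mul, Real.norm_of_nonneg (Real.exp_pos _).le]
  by_cases hc : t - z ^ 2 / (4 * u ^ 2) ≤ 0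
  · rw [hg.eq_zero_of_nonpos hc, norm_zero, zero_mul]
    positivity
  · push Not at hc
    rw [mul_assoc, ← Real.exp_add]
    refine mul_le_mul (hM _) (Real.exp_le_exp.2 ?_) (Real.exp_pos _).le hM0
    have h1 : z ^ 2 / (4 * u ^ 2) ≤ 2 + t := by linarith
    have h2 : z ^ 2 / (8 * (2 + t)) ≤ u ^ 2 / 2 := by
      rw [div_le_iff₀ (by positivity)] at h1 ⊢
      linarith
    linarith

theorem exists_heatPotential_zero_le (hg : IsBoundaryDatum T g) (τ : ℝ) : ∃ C : ℝ, 0 ≤ C ∧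
    ∀ t ≥ 0, t ≤ τ → ∀ z : ℝ,
      |heatPotential 0 g t z| ≤ C * Real.exp (-(z ^ 2 / (8 * (2 + t)))) := by
  obtain ⟨M, hM0, hM⟩ := hg.exists_abs_le
  obtain ⟨A, hA0, hA⟩ := exists_heatKernelDeriv_le_gaussian 0
  have hint : IntegrableOn (fun σ : ℝ => (Ioc 0 τ).indicator (fun σ => σ ^ (-(1 / 2) : ℝ)) σ)
      (Ioi 0) := by
    refine Integrable.integrableOn (IntegrableOn.integrable_indicator ?_ measurableSet_Ioc)
    exact (intervalIntegral.intervalIntegrable_rpow' (a := 0) (b := τ) (by norm_num)).1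
  set J := ∫ σ in Ioi (0 : ℝ), (Ioc 0 τ).indicator (fun σ => σ ^ (-(1 / 2) : ℝ)) σ
  have hJ : 0 ≤ J := setIntegral_nonneg measurableSet_Ioi fun σ hσ =>
    indicator_nonneg (fun x hx => Real.rpow_nonneg hx.1.le _) σ
  refine ⟨M * A * J, by positivity, fun t ht htτ z => ?_⟩
  rw [mul_assoc, mul_comm J, ← mul_assoc, ← integral_const_mul]
  rw [← Real.norm_eq_abs, heatPotential]
  refine norm_integral_le_of_norm_le (hint.const_mul _) ?_
  filter_upwards [ae_restrict_mem measurableSet_Ioi] with σ hσ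
  have hσ : 0 < σ := hσ
  rw [norm_mul]
  by_cases hc : t - σ ≤ 0
  · rw [hg.eq_zero_of_nonpos hc, norm_zero, zero_mul]
    have : 0 ≤ (Ioc 0 τ).indicator (fun σ => σ ^ (-(1 / 2) : ℝ)) σ :=
      indicator_nonneg (fun x hx => Real.rpow_nonneg hx.1.le _) σ
    positivity
  · push Not at hc
    rw [indicator_of_mem (show σ ∈ Ioc 0 τ from ⟨hσ, by linarith⟩), Real.rpow_neg hσ.le,
      ← Real.sqrt_eq_rpow]
    have h1 := hA σ hσ z
    rw [zero_add, pow_one] at h1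
    calc ‖g (t - σ)‖ * ‖heatKernelDeriv 0 σ z‖
        ≤ M * (A / Real.sqrt σ * Real.exp (-(z ^ 2 / (8 * σ)))) :=
          mul_le_mul (hM _) h1 (norm_nonneg _) hM0
      _ ≤ M * (A / Real.sqrt σ * Real.exp (-(z ^ 2 / (8 * (2 + t))))) := by
          gcongr
          linarith
      _ = _ := by ring

theorem exists_heatPotential_le_of_le (hg : IsBoundaryDatum T g) (j : ℕ) (τ : ℝ) :
    ∃ C : ℝ, 0 ≤ C ∧ ∀ t ≥ 0, t ≤ τ → ∀ z > 0,
      |heatPotential j g t z| ≤ C * Real.exp (-(z ^ 2 / (8 * (2 + t)))) := by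
  rcases Nat.even_or_odd' j with ⟨k, rfl | rfl⟩
  · obtain ⟨C, hC, h⟩ := exists_heatPotential_zero_le (hg.iteratedDeriv k) τ
    refine ⟨C, hC, fun t ht htτ z hz => ?_⟩
    have := h t ht htτ z
    rwa [heatPotential_iteratedDeriv hg 0 k t hz, zero_add] at this
  · obtain ⟨C, hC, h⟩ := exists_boundaryHeatSolution_le (hg.iteratedDeriv k)
    refine ⟨C, hC, fun t ht htτ z hz => ?_⟩
    have := h t ht z
    rw [boundaryHeatSolution_eq _ t hz, heatPotential_iteratedDeriv hg 1 k t hz, add_comm,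
      abs_mul] at this
    have h0 := abs_nonneg (heatPotential (2 * k + 1) g t z)
    have h2 : |(-2 : ℝ)| = 2 := by norm_num
    rw [h2] at this
    linarith

theorem exists_heatPotential_le_of_ge (hT : 0 < T) (hg : IsBoundaryDatum T g) (j : ℕ) :
    ∃ C : ℝ, 0 ≤ C ∧ ∀ t ≥ 2 * T, ∀ z : ℝ,
      |heatPotential j g t z| ≤
        C / Real.sqrt (2 + t) ^ (j + 1) * Real.exp (-(z ^ 2 / (8 * (2 + t)))) := by
  obtain ⟨A, hA0, hA⟩ := exists_heatKernelDeriv_le_gaussian j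
  set J := ∫ x, |g x|
  have hJ : 0 ≤ J := integral_nonneg fun _ => abs_nonneg _
  set K := Real.sqrt (2 + 2 / T)
  refine ⟨A * K ^ (j + 1) * J, by positivity, fun t ht z => ?_⟩
  have ht0 : 0 < t := by linarith
  have hgi : Integrable fun σ => |g (t - σ)| := by
    simpa using (hg.integrable_comp_mul t (f := fun _ => (1 : ℝ)) continuous_const).norm
  have hJt : ∫ σ in Ioi (0 : ℝ), |g (t - σ)| ≤ J := by
    refine (setIntegral_le_integral hgi (Eventually.of_forall fun _ => abs_nonneg _)).trans_eq ?_
    exact integral_sub_left_eq_self (fun x => |g x|) volume t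
  set E := A * K ^ (j + 1) / Real.sqrt (2 + t) ^ (j + 1) * Real.exp (-(z ^ 2 / (8 * (2 + t))))
  have hE : 0 ≤ E := by positivity
  have hb : |heatPotential j g t z| ≤ ∫ σ in Ioi (0 : ℝ), E * |g (t - σ)| := by
    rw [← Real.norm_eq_abs, heatPotential]
    refine norm_integral_le_of_norm_le (hgi.integrableOn.const_mul E) ?_
    filter_upwards [ae_restrict_mem measurableSet_Ioi] with σ hσ
    have hσ : 0 < σ := hσ
    rw [norm_mul, mul_comm]
    by_cases hc : t - σ ∈ Icc 0 T
    · refine mul_le_mul_of_nonneg_right ((hA σ hσ z).trans ?_) (abs_nonneg _)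
      have hσt : t / 2 ≤ σ := by linarith [hc.2]
      have hσt' : σ ≤ 2 + t := by linarith [hc.1]
      have hK : Real.sqrt (2 + t) ≤ K * Real.sqrt σ := by
        rw [← Real.sqrt_mul (by positivity)]
        refine Real.sqrt_le_sqrt ?_
        have h1 : 1 ≤ σ / T := by rw [le_div_iff₀ hT]; linarith [hc.2]
        have h2 : (2 + 2 / T) * σ = 2 * σ + 2 * (σ / T) := by ring
        rw [h2]
        linarith
      have hs : 0 < Real.sqrt σ := Real.sqrt_pos.2 hσ
      have hs2 : 0 < Real.sqrt (2 + t) := Real.sqrt_pos.2 (by linarith)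
      refine mul_le_mul ?_ (Real.exp_le_exp.2 ?_) (Real.exp_pos _).le (by positivity)
      · rw [div_le_div_iff₀ (by positivity) (by positivity), mul_assoc, ← mul_pow]
        gcongr
      · gcongr
    · rw [hg.eq_zero hc]
      simp
  rw [integral_const_mul] at hb
  refine hb.trans ((mul_le_mul_of_nonneg_left hJt hE).trans_eq ?_)
  simp only [E]
  ring

theorem IsBoundaryDatum.primitive {h : ℝ → ℝ} (hh : IsBoundaryDatum T h)
    (h0 : ∫ t in (0 : ℝ)..T, h t = 0) : IsBoundaryDatum T fun x => ∫ t in (0 : ℝ)..x, h t := by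
  have hd : ∀ x, HasDerivAt (fun x => ∫ t in (0 : ℝ)..x, h t) (h x) x := fun x =>
    hh.continuous.integral_hasStrictDerivAt 0 x |>.hasDerivAt
  refine ⟨contDiff_infty_iff_deriv.2 ⟨fun x => (hd x).differentiableAt, ?_⟩, ?_⟩
  · rw [show _root_.deriv (fun x => ∫ t in (0 : ℝ)..x, h t) = h from funext fun x => (hd x).deriv]
    exact hh.contDiff
  · refine closure_minimal (fun x hx => ?_) isClosed_Icc
    by_contra hx'
    refine hx ?_
    rcases lt_or_ge x 0 with hneg | hpos
    · refine (intervalIntegral.integral_congr (g := fun _ => (0 : ℝ)) fun t ht => ?_).trans (by simp)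
      rw [uIcc_of_ge hneg.le] at ht
      exact hh.eq_zero_of_nonpos ht.2
    · have hTx : T < x := not_le.1 fun hle => hx' ⟨hpos, hle⟩
      have hT' : ∫ t in T..x, h t = 0 := by
        rw [intervalIntegral.integral_of_le hTx.le]
        refine (setIntegral_congr_fun (g := fun _ => (0 : ℝ)) measurableSet_Ioc fun t ht => ?_).trans
          (by simp)
        exact hh.eq_zero fun hc => not_le.2 ht.1 hc.2
      have := intervalIntegral.integral_add_adjacent_intervals
        (hh.continuous.intervalIntegrable 0 T (μ := volume)) (hh.continuous.intervalIntegrable T x)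
      simp only
      rw [← this, h0, hT', add_zero]

theorem moment_primitive {h : ℝ → ℝ} (hh : Continuous h) (h0 : ∫ t in (0 : ℝ)..T, h t = 0)
    (k : ℕ) : ∫ x in (0 : ℝ)..T, x ^ k * ∫ t in (0 : ℝ)..x, h t =
      -(((k : ℝ) + 1)⁻¹ * ∫ x in (0 : ℝ)..T, x ^ (k + 1) * h x) := by
  have hd : ∀ x, HasDerivAt (fun x => ∫ t in (0 : ℝ)..x, h t) (h x) x := fun x =>
    (hh.integral_hasStrictDerivAt 0 x).hasDerivAt
  have hp : ∀ x : ℝ, HasDerivAt (fun x : ℝ => ((k : ℝ) + 1)⁻¹ * x ^ (k + 1)) (x ^ k) x := fun x => by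
    refine ((hasDerivAt_pow (k + 1) x).const_mul _).congr_deriv ?_
    push_cast
    field_simp
  have := intervalIntegral.integral_mul_deriv_eq_deriv_mul (a := 0) (b := T)
    (fun x _ => hd x) (fun x _ => hp x) (hh.intervalIntegrable _ _)
    ((continuous_pow k).intervalIntegrable _ _)
  rw [h0, intervalIntegral.integral_same, zero_mul, zero_mul, sub_zero, zero_sub] at this
  rw [← intervalIntegral.integral_const_mul]
  calc _ = _ := intervalIntegral.integral_congr fun x _ => mul_comm _ _
    _ = _ := this
    _ = _ := by congr 1; exact intervalIntegral.integral_congr fun x _ => by ring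

/-- A datum with `n` vanishing moments is the `n`-th derivative of a datum. -/
theorem IsBoundaryDatum.exists_iteratedDeriv_eq (n : ℕ) {h : ℝ → ℝ}
    (hh : IsBoundaryDatum T h) (hmom : ∀ k < n, ∫ t in (0 : ℝ)..T, t ^ k * h t = 0) :
    ∃ H, IsBoundaryDatum T H ∧ _root_.iteratedDeriv n H = h := by
  induction n generalizing h with
  | zero => exact ⟨h, hh, by simp⟩
  | succ n ih =>
    have h0 : ∫ t in (0 : ℝ)..T, h t = 0 := by simpa using hmom 0 n.succ_pos
    obtain ⟨H, hH, hHn⟩ := ih (hh.primitive h0) fun k hk => by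
      rw [moment_primitive hh.continuous h0, hmom (k + 1) (by omega), mul_zero, neg_zero]
    refine ⟨H, hH, ?_⟩
    rw [iteratedDeriv_succ, hHn]
    exact funext fun x => (hh.continuous.integral_hasStrictDerivAt 0 x).hasDerivAt.deriv

theorem exists_heatPotential_decay (hT : 0 < T) (n : ℕ) {h : ℝ → ℝ} (hh : IsBoundaryDatum T h)
    (hmom : ∀ k < n, ∫ t in (0 : ℝ)..T, t ^ k * h t = 0) (α : ℕ) :
    ∃ C : ℝ, 0 ≤ C ∧ ∀ t ≥ 0, ∀ z > 0, |heatPotential (α + 1) h t z| ≤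
      C / (2 + t) ^ (n + 1) * Real.exp (-(z ^ 2 / (8 * (2 + t)))) := by
  obtain ⟨H, hH, rfl⟩ := hh.exists_iteratedDeriv_eq n hmom
  obtain ⟨A, hA0, hA⟩ := exists_heatPotential_le_of_le hh (α + 1) (2 * T)
  obtain ⟨B, hB0, hB⟩ := exists_heatPotential_le_of_ge hT hH (α + 1 + 2 * n)
  refine ⟨A * (2 + 2 * T) ^ (n + 1) + B, by positivity, fun t ht z hz => ?_⟩
  rcases le_total t (2 * T) with htT | htT
  · refine (hA t ht htT z hz).trans ?_
    refine mul_le_mul_of_nonneg_right ?_ (Real.exp_pos _).le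
    rw [le_div_iff₀ (by positivity)]
    have : A * (2 + t) ^ (n + 1) ≤ A * (2 + 2 * T) ^ (n + 1) := by gcongr
    linarith
  · rw [heatPotential_iteratedDeriv hH _ _ _ hz]
    refine (hB t htT z).trans ?_
    refine mul_le_mul_of_nonneg_right ?_ (Real.exp_pos _).le
    have h1 : 1 ≤ Real.sqrt (2 + t) := Real.one_le_sqrt.2 (by linarith)
    have h2 : (2 + t) ^ (n + 1) ≤ Real.sqrt (2 + t) ^ (α + 1 + 2 * n + 1) := by
      have : (2 + t) ^ (n + 1) = Real.sqrt (2 + t) ^ (2 * (n + 1)) := by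
        rw [pow_mul, Real.sq_sqrt (by linarith)]
      rw [this]
      exact pow_le_pow_right₀ h1 (by omega)
    have h3 : 0 ≤ A * (2 + 2 * T) ^ (n + 1) := by positivity
    have h4 : (0 : ℝ) < (2 + t) ^ (n + 1) := by positivity
    exact div_le_div₀ (by linarith) (by linarith) h4 h2

theorem HasWeakDeriv.weakDeriv_ae_eq {I : Set ℝ} {α : ℕ} {f g : ℝ → ℝ}
    (hg : HasWeakDeriv I α f g) :
    ∀ᵐ z ∂volume.restrict (interior I), weakDeriv I α f z = g z := by
  have hex : ∃ g, HasWeakDeriv I α f g := ⟨g, hg⟩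
  have hw : HasWeakDeriv I α f (weakDeriv I α f) := by
    rw [weakDeriv, dif_pos hex]
    exact hex.choose_spec
  rw [ae_restrict_iff' isOpen_interior.measurableSet]
  have key := isOpen_interior.ae_eq_zero_of_integral_contDiff_smul_eq_zero
    (hw.locInt_right.sub hg.locInt_right) (μ := volume) fun φ hφ hφc hφs => by
      have hzero : ∀ z ∉ interior I,
          φ z • (weakDeriv I α f - g) z = 0 := fun z hz => by
        rw [image_eq_zero_of_notMem_tsupport fun h => hz (hφs h), zero_smul]
      rw [← setIntegral_eq_integral_of_forall_compl_eq_zero hzero]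
      have h1 := (hw.integral_eq φ hφ hφc hφs).symm.trans (hg.integral_eq φ hφ hφc hφs)
      have h2 := mul_left_cancel₀ (pow_ne_zero α (by norm_num : (-1 : ℝ) ≠ 0)) h1
      have hi : ∀ k : ℝ → ℝ, LocallyIntegrableOn k (interior I) →
          IntegrableOn (fun z => k z * φ z) (interior I) := fun k hk => by
        have hk' := (hk.integrableOn_compact_subset hφs hφc).mul_continuousOn
          hφ.continuous.continuousOn hφc
        have : Integrable fun z => k z * φ z :=
          (integrableOn_iff_integrable_of_support_subset fun z hz => subset_tsupport φ
            (right_ne_zero_of_mul hz)).1 hk'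
        exact this.integrableOn
      have h3 := integral_sub (hi _ hw.locInt_right) (hi _ hg.locInt_right)
      rw [h2, sub_self] at h3
      rw [← h3]
      congr 1
      ext z
      simp only [Pi.sub_apply, smul_eq_mul]
      ring
  filter_upwards [key] with z hz hzI
  exact sub_eq_zero.1 (hz hzI)

theorem integral_Ioi_mul_deriv_of_tsupport_subset {f f' φ : ℝ → ℝ}
    (hf : ∀ z > 0, HasDerivAt f (f' z) z) (hf' : ContinuousOn f' (Ioi 0)) (hφ : ContDiff ℝ ∞ φ)
    (hc : HasCompactSupport φ) (hs : tsupport φ ⊆ Ioi 0) :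
    ∫ z in Ioi (0 : ℝ), f z * deriv φ z = -∫ z in Ioi (0 : ℝ), f' z * φ z := by
  have hfc : ContinuousOn f (Ioi 0) := fun z hz => (hf z hz).continuousAt.continuousWithinAt
  have hi : ∀ k ψ : ℝ → ℝ, ContinuousOn k (Ioi 0) → Continuous ψ → tsupport ψ ⊆ tsupport φ →
      IntegrableOn (k * ψ) (Ioi 0) := fun k ψ hk hψ hψs => by
    have hk' : IntegrableOn (k * ψ) (tsupport φ) :=
      ((hk.mono hs).mul hψ.continuousOn).integrableOn_compact hc
    exact ((integrableOn_iff_integrable_of_support_subset fun z hz =>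
      hψs (subset_tsupport ψ (right_ne_zero_of_mul hz))).1 hk').integrableOn
  have hφd : ∀ z ∈ Ioi (0 : ℝ), HasDerivAt φ (deriv φ z) z := fun z _ =>
    (hφ.differentiable (by simp) z).hasDerivAt
  have hdc : Continuous (deriv φ) := (contDiff_infty_iff_deriv.1 hφ).2.continuous
  have hzero : ∀ l : Filter ℝ, (∀ᶠ z in l, φ z = 0) → Tendsto (f * φ) l (𝓝 0) := fun l hl => by
    refine tendsto_const_nhds.congr' ?_
    filter_upwards [hl] with z hz
    simp [hz]
  have h0 : ∀ᶠ z in 𝓝[>] (0 : ℝ), φ z = 0 := by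
    have : (0 : ℝ) ∉ tsupport φ := fun h => lt_irrefl (0 : ℝ) (hs h)
    filter_upwards [nhdsWithin_le_nhds (notMem_tsupport_iff_eventuallyEq.1 this)] with z hz using hz
  have hinf : ∀ᶠ z in atTop, φ z = 0 := by
    obtain ⟨b, hb⟩ := hc.isCompact.bddAbove
    filter_upwards [eventually_gt_atTop b] with z hz
    exact image_eq_zero_of_notMem_tsupport fun h => not_le.2 hz (hb h)
  rw [integral_Ioi_mul_deriv_eq_deriv_mul hf hφd (hi f _ hfc hdc tsupport_deriv_subset)
    (hi f' φ hf' hφ.continuous subset_rfl) (hzero _ h0) (hzero _ hinf)]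
  ring

theorem integral_Ioi_mul_iteratedDeriv {f : ℕ → ℝ → ℝ}
    (hf : ∀ j, ∀ z > 0, HasDerivAt (f j) (f (j + 1) z) z) (α : ℕ) {φ : ℝ → ℝ}
    (hφ : ContDiff ℝ ∞ φ) (hc : HasCompactSupport φ) (hs : tsupport φ ⊆ Ioi 0) :
    ∫ z in Ioi (0 : ℝ), f 0 z * iteratedDeriv α φ z =
      (-1) ^ α * ∫ z in Ioi (0 : ℝ), f α z * φ z := by
  induction α generalizing φ with
  | zero => simp
  | succ α ih =>
    rw [iteratedDeriv_succ', ih (contDiff_infty_iff_deriv.1 hφ).2 hc.deriv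
      (tsupport_deriv_subset.trans hs), integral_Ioi_mul_deriv_of_tsupport_subset (hf α)
      (fun z hz => (hf (α + 1) z hz).continuousAt.continuousWithinAt) hφ hc hs]
    ring

theorem hasWeakDeriv_of_hasDerivAt {f : ℕ → ℝ → ℝ} {v : ℝ → ℝ} (hv : EqOn v (f 0) (Ioi 0))
    (hf : ∀ j, ∀ z > 0, HasDerivAt (f j) (f (j + 1) z) z) (α : ℕ) :
    HasWeakDeriv (Ioi 0) α v (f α) := by
  have hloc : ∀ j, LocallyIntegrableOn (f j) (Ioi 0) := fun j =>
    ContinuousOn.locallyIntegrableOn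
      (fun z hz => (hf j z hz).continuousAt.continuousWithinAt) measurableSet_Ioi
  have hvc : ContinuousOn v (Ioi 0) := ContinuousOn.congr
    (fun z hz => (hf 0 z hz).continuousAt.continuousWithinAt) hv
  refine ⟨?_, ?_, fun φ hφ hc hs => ?_⟩ <;> rw [interior_Ioi] at *
  · exact hvc.locallyIntegrableOn measurableSet_Ioi
  · exact hloc α
  · rw [← integral_Ioi_mul_iteratedDeriv hf α hφ hc hs]
    exact setIntegral_congr_fun measurableSet_Ioi fun z hz => by simp only [hv hz]

theorem exists_weighted_gaussian_le (m : ℕ) : ∃ K : ℝ, 0 ≤ K ∧ ∀ L ≥ 1, ∀ z : ℝ,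
    (1 + z ^ 2) ^ m * Real.exp (-(z ^ 2 / (8 * L))) ^ 2 ≤
      K * L ^ m * Real.exp (-(1 / (8 * L)) * z ^ 2) := by
  obtain ⟨C, hC, hC'⟩ := exists_pow_mul_exp_neg_sq_le (2 * m) (c := 1 / 8) (by norm_num)
  refine ⟨C, hC, fun L hL z => ?_⟩
  have hL0 : 0 < L := by linarith
  have hs : 0 < Real.sqrt L := Real.sqrt_pos.2 hL0
  have hs2 := Real.sq_sqrt hL0.le
  have h1 := hC' (|z| / Real.sqrt L) (by positivity)
  have hy : 0 ≤ |z| / Real.sqrt L := by positivity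
  have h2 : 1 + z ^ 2 ≤ L * (1 + |z| / Real.sqrt L) ^ 2 := by
    have : L * (|z| / Real.sqrt L) ^ 2 = z ^ 2 := by
      rw [div_pow, hs2, sq_abs]; field_simp
    nlinarith [mul_nonneg hL0.le hy]
  have he : Real.exp (-(z ^ 2 / (8 * L))) ^ 2 =
      Real.exp (-(1 / 8 * (|z| / Real.sqrt L) ^ 2)) * Real.exp (-(1 / (8 * L)) * z ^ 2) := by
    rw [← Real.exp_add, ← Real.exp_nat_mul, div_pow, hs2, sq_abs]
    congr 1
    push_cast
    field_simp
    ring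
  rw [he]
  calc (1 + z ^ 2) ^ m * (Real.exp (-(1 / 8 * (|z| / Real.sqrt L) ^ 2)) *
        Real.exp (-(1 / (8 * L)) * z ^ 2))
      ≤ (L * (1 + |z| / Real.sqrt L) ^ 2) ^ m * (Real.exp (-(1 / 8 * (|z| / Real.sqrt L) ^ 2)) *
        Real.exp (-(1 / (8 * L)) * z ^ 2)) := by gcongr
    _ = ((1 + |z| / Real.sqrt L) ^ (2 * m) * Real.exp (-(1 / 8 * (|z| / Real.sqrt L) ^ 2))) *
        L ^ m * Real.exp (-(1 / (8 * L)) * z ^ 2) := by rw [mul_pow, ← pow_mul]; ring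
    _ ≤ _ := by gcongr

theorem exists_weighted_integral_le (m : ℕ) : ∃ K : ℝ, 0 ≤ K ∧ ∀ L ≥ 1, ∀ D ≥ 0, ∀ f : ℝ → ℝ,
    ContinuousOn f (Ioi 0) → (∀ z > 0, |f z| ≤ D * Real.exp (-(z ^ 2 / (8 * L)))) →
    IntegrableOn (fun z => (1 + z ^ 2) ^ m * f z ^ 2) (Ioi 0) ∧
      ∫ z in Ioi (0 : ℝ), (1 + z ^ 2) ^ m * f z ^ 2 ≤ K * D ^ 2 * L ^ m * Real.sqrt L := by
  obtain ⟨K, hK, hK'⟩ := exists_weighted_gaussian_le m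
  refine ⟨K * (Real.sqrt (8 * Real.pi) / 2), by positivity, fun L hL D hD f hfc hf => ?_⟩
  have hL0 : 0 < L := by linarith
  have hg : IntegrableOn (fun z : ℝ => D ^ 2 * (K * L ^ m) * Real.exp (-(1 / (8 * L)) * z ^ 2))
      (Ioi 0) := ((integrable_exp_neg_mul_sq (by positivity)).const_mul _).integrableOn
  have hle : ∀ z ∈ Ioi (0 : ℝ), (1 + z ^ 2) ^ m * f z ^ 2 ≤
      D ^ 2 * (K * L ^ m) * Real.exp (-(1 / (8 * L)) * z ^ 2) := fun z hz => by
    have h1 : f z ^ 2 ≤ (D * Real.exp (-(z ^ 2 / (8 * L)))) ^ 2 := by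
      rw [← sq_abs (f z)]
      exact pow_le_pow_left₀ (abs_nonneg _) (hf z hz) 2
    calc (1 + z ^ 2) ^ m * f z ^ 2
        ≤ (1 + z ^ 2) ^ m * (D * Real.exp (-(z ^ 2 / (8 * L)))) ^ 2 := by gcongr
      _ = D ^ 2 * ((1 + z ^ 2) ^ m * Real.exp (-(z ^ 2 / (8 * L))) ^ 2) := by ring
      _ ≤ D ^ 2 * (K * L ^ m * Real.exp (-(1 / (8 * L)) * z ^ 2)) :=
          mul_le_mul_of_nonneg_left (hK' L hL z) (by positivity)
      _ = _ := by ring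
  have hint : IntegrableOn (fun z => (1 + z ^ 2) ^ m * f z ^ 2) (Ioi 0) := by
    refine hg.mono' (ContinuousOn.aestronglyMeasurable (by fun_prop) measurableSet_Ioi) ?_
    filter_upwards [ae_restrict_mem measurableSet_Ioi] with z hz
    rw [Real.norm_of_nonneg (by positivity)]
    exact hle z hz
  refine ⟨hint, (setIntegral_mono_on hint hg measurableSet_Ioi hle).trans_eq ?_⟩
  rw [integral_const_mul, integral_gaussian_Ioi,
    show Real.pi / (1 / (8 * L)) = 8 * Real.pi * L by field_simp, Real.sqrt_mul (by positivity)]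
  ring

/-- Gaussian bounds on the classical derivatives control the weighted Sobolev norm. -/
theorem exists_weightedSobolevNorm_le (s m : ℕ) (D : ℕ → ℝ) (hD : ∀ α, 0 ≤ D α) :
    ∃ K : ℝ, 0 ≤ K ∧ ∀ L ≥ 1, ∀ δ ≥ 0, ∀ (v : ℝ → ℝ) (f : ℕ → ℝ → ℝ), EqOn v (f 0) (Ioi 0) →
      (∀ j, ∀ z > 0, HasDerivAt (f j) (f (j + 1) z) z) →
      (∀ j, ∀ z > 0, |f j z| ≤ D j * δ * Real.exp (-(z ^ 2 / (8 * L)))) →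
      MemWeightedSobolev (Ioi 0) s m v ∧
        weightedSobolevNorm (Ioi 0) s m v ≤ Real.sqrt (K * δ ^ 2 * L ^ m * Real.sqrt L) := by
  obtain ⟨K, hK, hK'⟩ := exists_weighted_integral_le m
  obtain ⟨K₀, hK₀, hK₀'⟩ := exists_weighted_integral_le 0
  refine ⟨∑ α ∈ Finset.range (s + 1), K * D α ^ 2,
    Finset.sum_nonneg fun α _ => by positivity, fun L hL δ hδ v f hv hf hb => ?_⟩
  have hfc : ∀ j, ContinuousOn (f j) (Ioi 0) := fun j z hz =>
    (hf j z hz).continuousAt.continuousWithinAt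
  have hwd := hasWeakDeriv_of_hasDerivAt hv hf
  have hae : ∀ α, (fun z => (1 + z ^ 2) ^ m * f α z ^ 2) =ᵐ[volume.restrict (Ioi 0)]
      fun z => (1 + z ^ 2) ^ m * weakDeriv (Ioi 0) α v z ^ 2 := fun α => by
    have := (hwd α).weakDeriv_ae_eq
    rw [interior_Ioi] at this
    filter_upwards [this] with z hz
    rw [hz]
  have hmain := fun α => hK' L hL (D α * δ) (mul_nonneg (hD α) hδ) (f α) (hfc α) (hb α)
  refine ⟨⟨fun α _ => ⟨f α, hwd α, ?_⟩, fun α _ => (hmain α).1.congr (hae α)⟩, ?_⟩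
  · refine (memLp_two_iff_integrable_sq
      ((hfc α).aestronglyMeasurable measurableSet_Ioi)).2 ?_
    simpa [IntegrableOn] using (hK₀' L hL (D α * δ) (mul_nonneg (hD α) hδ) (f α) (hfc α) (hb α)).1
  · refine Real.sqrt_le_sqrt ?_
    rw [Finset.sum_mul, Finset.sum_mul, Finset.sum_mul]
    refine Finset.sum_le_sum fun α _ => ?_
    rw [← integral_congr_ae (hae α)]
    exact (hmain α).2.trans_eq (by ring)

theorem deriv_deriv_nonpos_of_isLocalMax {f : ℝ → ℝ} {x : ℝ} (hf : ContinuousAt f x)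
    (hmax : IsLocalMax f x) : deriv (deriv f) x ≤ 0 := by
  by_contra! hpos
  have hmin := isLocalMin_of_deriv_deriv_pos hpos hmax.deriv_eq_zero hf
  have hconst : f =ᶠ[𝓝 x] fun _ => f x := by
    filter_upwards [hmax, hmin] with y h1 h2 using le_antisymm h1 h2
  have := hconst.deriv.deriv_eq
  simp at this
  linarith

theorem deriv_nonneg_of_le_left {f : ℝ → ℝ} {f' a b : ℝ} (hab : a < b) (hf : HasDerivAt f f' b)
    (hle : ∀ x ∈ Icc a b, f x ≤ f b) : 0 ≤ f' := by
  have h1 := (hasDerivAt_iff_tendsto_slope.1 hf).mono_left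
    (nhdsWithin_mono b (fun x (hx : x < b) => hx.ne) : 𝓝[<] b ≤ _)
  refine ge_of_tendsto h1 ?_
  filter_upwards [Ioo_mem_nhdsLT hab] with x hx
  rw [slope_def_field]
  exact div_nonneg_of_nonpos (by linarith [hle x ⟨hx.1.le, hx.2.le⟩]) (by linarith [hx.2])

namespace IsHalfLineHeatSolution

variable {h₁ h₂ : ℝ → ℝ} {V W : ℝ → ℝ → ℝ}

theorem sub (hV : IsHalfLineHeatSolution h₁ V) (hW : IsHalfLineHeatSolution h₂ W) :
    IsHalfLineHeatSolution (fun t => h₁ t - h₂ t) fun t z => V t z - W t z := by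
  have hd : ∀ t > 0, ∀ z > 0,
      deriv (fun z => V t z - W t z) =ᶠ[𝓝 z] fun z => deriv (V t) z - deriv (W t) z :=
    fun t ht z hz => by
      filter_upwards [Ioi_mem_nhds hz] with y hy
      exact deriv_fun_sub (hV.differentiable_space t ht y hy) (hW.differentiable_space t ht y hy)
  constructor
  · exact hV.continuousOn.sub hW.continuousOn
  · intro τ
    obtain ⟨M, hM⟩ := hV.bounded τ
    obtain ⟨N, hN⟩ := hW.bounded τ
    exact ⟨M + N, fun t ht z hz => (abs_sub _ _).trans (add_le_add (hM t ht z hz) (hN t ht z hz))⟩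
  · exact fun t ht z hz => (hV.differentiable_time t ht z hz).fun_sub
      (hW.differentiable_time t ht z hz)
  · exact fun t ht z hz => (hV.differentiable_space t ht z hz).fun_sub
      (hW.differentiable_space t ht z hz)
  · exact fun t ht z hz => ((hV.differentiable_space_two t ht z hz).fun_sub
      (hW.differentiable_space_two t ht z hz)).congr_of_eventuallyEq (hd t ht z hz)
  · intro t ht z hz
    rw [deriv_fun_sub (hV.differentiable_time t ht z hz) (hW.differentiable_time t ht z hz),
      (hd t ht z hz).deriv_eq, deriv_fun_sub (hV.differentiable_space_two t ht z hz)
      (hW.differentiable_space_two t ht z hz)]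
    linarith [hV.heat t ht z hz, hW.heat t ht z hz]
  · exact fun t ht => by rw [hV.boundary t ht, hW.boundary t ht]
  · exact fun z hz => by rw [hV.initial z hz, hW.initial z hz, sub_zero]

theorem le_barrier (hV : IsHalfLineHeatSolution (fun _ => 0) V) {τ M R η : ℝ} (hτ : 0 ≤ τ)
    (hM0 : 0 ≤ M) (hM : ∀ t ∈ Icc 0 τ, ∀ z ≥ 0, |V t z| ≤ M) (hR : 0 < R) (hη : 0 < η) :
    ∀ z ∈ Icc 0 R, V τ z ≤ M * (z ^ 2 + 2 * τ) / R ^ 2 + η * τ := by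
  set w : ℝ × ℝ → ℝ := fun p => V p.1 p.2 - (M * (p.2 ^ 2 + 2 * p.1) / R ^ 2 + η * p.1)
  have hwc : ContinuousOn w (Icc 0 τ ×ˢ Icc 0 R) := by
    refine ContinuousOn.sub (hV.continuousOn.mono (prod_mono Icc_subset_Ici_self
      Icc_subset_Ici_self)) (Continuous.continuousOn ?_)
    fun_prop
  obtain ⟨⟨a, b⟩, ⟨ha, hb⟩, hmax⟩ := (isCompact_Icc.prod isCompact_Icc).exists_isMaxOn
    ⟨(0, 0), ⟨le_rfl, hτ⟩, le_rfl, hR.le⟩ hwc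
  have hmax' : ∀ t ∈ Icc 0 τ, ∀ z ∈ Icc 0 R, w (t, z) ≤ w (a, b) := fun t ht z hz =>
    hmax (mk_mem_prod ht hz)
  suffices hw : w (a, b) ≤ 0 by
    intro z hz
    have := (hmax' τ ⟨hτ, le_rfl⟩ z hz).trans hw
    simp only [w] at this
    linarith
  have ha0 : 0 ≤ a := ha.1
  have hb0 : 0 ≤ b := hb.1
  have hbar : 0 ≤ M * (b ^ 2 + 2 * a) / R ^ 2 + η * a := by positivity
  rcases ha0.eq_or_lt with rfl | ha0
  · have h1 := hV.initial b hb0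
    simp only [w, h1]
    linarith
  rcases hb0.eq_or_lt with rfl | hb0
  · have h1 := hV.boundary a ha0.le
    simp only [w, h1]
    linarith
  rcases hb.2.eq_or_lt with rfl | hbR
  · have h1 := (le_abs_self _).trans (hM a ha b hb0.le)
    have h2 : M * (b ^ 2 + 2 * a) / b ^ 2 = M + M * (2 * a) / b ^ 2 := by field_simp
    have h3 : 0 ≤ M * (2 * a) / b ^ 2 + η * a := by positivity
    simp only [w, h2]
    linarith
  exfalso
  have ht := (hV.differentiable_time a ha0 b hb0).hasDerivAt
  have hwt : HasDerivAt (fun r => w (r, b)) (deriv (fun r => V r b) a - (2 * M / R ^ 2 + η)) a := by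
    refine ht.fun_sub (HasDerivAt.congr_deriv (((((hasDerivAt_id a).const_mul 2).const_add
      (b ^ 2)).const_mul M |>.div_const (R ^ 2)).fun_add ((hasDerivAt_id a).const_mul η)) ?_)
    ring
  have h1 := deriv_nonneg_of_le_left ha0 hwt fun x hx =>
    hmax' x ⟨hx.1, hx.2.trans ha.2⟩ b ⟨hb0.le, hbR.le⟩
  have hbz : ∀ y : ℝ, HasDerivAt (fun y => M * (y ^ 2 + 2 * a) / R ^ 2 + η * a)
      (2 * M / R ^ 2 * y) y := fun y => by
    refine ((((hasDerivAt_pow 2 y).add_const (2 * a)).const_mul M |>.div_const (R ^ 2)).add_const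
      (η * a)).congr_deriv ?_
    push_cast
    ring
  have hwz : deriv (fun z => w (a, z)) =ᶠ[𝓝 b] fun y => deriv (V a) y - 2 * M / R ^ 2 * y := by
    filter_upwards [Ioi_mem_nhds hb0] with y hy
    exact ((hV.differentiable_space a ha0 y hy).hasDerivAt.fun_sub (hbz y)).deriv
  have hloc : IsLocalMax (fun z => w (a, z)) b := by
    filter_upwards [Icc_mem_nhds hb0 hbR] with z hz using hmax' a ha z hz
  have hcont : ContinuousAt (fun z => w (a, z)) b :=
    ((hV.differentiable_space a ha0 b hb0).hasDerivAt.fun_sub (hbz b)).continuousAt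
  have h2 := deriv_deriv_nonpos_of_isLocalMax hcont hloc
  rw [hwz.deriv_eq, ((hV.differentiable_space_two a ha0 b hb0).hasDerivAt.fun_sub
    ((hasDerivAt_id' b).const_mul (2 * M / R ^ 2))).deriv] at h2
  linarith [hV.heat a ha0 b hb0]

theorem nonpos (hV : IsHalfLineHeatSolution (fun _ => 0) V) {t z : ℝ} (ht : 0 ≤ t) (hz : 0 ≤ z) :
    V t z ≤ 0 := by
  obtain ⟨M, hM⟩ := hV.bounded t
  have hM0 : 0 ≤ M := (abs_nonneg _).trans (hM 0 ⟨le_rfl, ht⟩ 0 le_rfl)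
  have hlim : Tendsto (fun R : ℝ => M * (z ^ 2 + 2 * t) / R ^ 2 + R⁻¹ * t) atTop (𝓝 0) := by
    simpa using ((tendsto_pow_atTop (two_ne_zero)).const_div_atTop (M * (z ^ 2 + 2 * t))).add
      (tendsto_inv_atTop_zero.mul_const t)
  refine ge_of_tendsto hlim ?_
  filter_upwards [eventually_gt_atTop 0, eventually_ge_atTop z] with R hR hzR
  exact hV.le_barrier ht hM0 hM hR (inv_pos.2 hR) z ⟨hz, hzR⟩

theorem unique {h : ℝ → ℝ} (hV : IsHalfLineHeatSolution h V) (hW : IsHalfLineHeatSolution h W)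
    {t z : ℝ} (ht : 0 ≤ t) (hz : 0 ≤ z) : V t z = W t z := by
  have h1 := hV.sub hW
  have h2 := hW.sub hV
  simp only [sub_self] at h1 h2
  exact le_antisymm (sub_nonpos.1 (h1.nonpos ht hz)) (sub_nonpos.1 (h2.nonpos ht hz))

end IsHalfLineHeatSolution

theorem isHalfLineHeatSolution_boundaryHeatSolution {T : ℝ} {h : ℝ → ℝ}
    (hh : IsBoundaryDatum T h) : IsHalfLineHeatSolution h (boundaryHeatSolution h) := by
  have hd : ∀ t, ∀ z > 0, HasDerivAt (boundaryHeatSolution h t) (-2 * heatPotential 2 h t z) z :=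
    fun t z hz => by
      refine ((hasDerivAt_heatPotential hh 1 t hz).const_mul (-2)).congr_of_eventuallyEq ?_
      filter_upwards [Ioi_mem_nhds hz] with y hy using boundaryHeatSolution_eq h t hy
  have hd2 : ∀ t, ∀ z > 0,
      HasDerivAt (deriv (boundaryHeatSolution h t)) (-2 * heatPotential 3 h t z) z :=
    fun t z hz => by
      refine ((hasDerivAt_heatPotential hh 2 t hz).const_mul (-2)).congr_of_eventuallyEq ?_
      filter_upwards [Ioi_mem_nhds hz] with y hy using (hd t y hy).deriv
  have ht := hasDerivAt_boundaryHeatSolution_time hh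
  constructor
  · exact (continuous_boundaryHeatSolution hh).continuousOn
  · intro τ
    obtain ⟨C, hC, hb⟩ := exists_boundaryHeatSolution_le hh
    refine ⟨C, fun t ht z _ => (hb t ht.1 z).trans (mul_le_of_le_one_right hC ?_)⟩
    have : 0 ≤ 8 * (2 + t) := by linarith [ht.1]
    exact Real.exp_le_one_iff.2 (neg_nonpos.2 (by positivity))
  · exact fun t _ z _ => (ht t z).differentiableAt
  · exact fun t _ z hz => (hd t z hz).differentiableAt
  · exact fun t _ z hz => (hd2 t z hz).differentiableAt
  · intro t _ z hz
    rw [(ht t z).deriv, (hd2 t z hz).deriv, boundaryHeatSolution_eq _ t hz,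
      heatPotential_deriv hh 1 t hz, sub_self]
  · exact fun t _ => boundaryHeatSolution_zero_right h t
  · exact fun z _ => boundaryHeatSolution_zero_left hh z

theorem exists_sobolev_decay {T : ℝ} (hT : 0 < T) (s n m : ℕ) (hm : m ≤ 2 * n + 1) {h : ℝ → ℝ}
    (hh : IsBoundaryDatum T h) (hmom : ∀ k < n, ∫ t in (0 : ℝ)..T, t ^ k * h t = 0) :
    ∃ C : ℝ, ∀ t : ℝ, 0 ≤ t →
      MemWeightedSobolev (Ioi 0) s m (boundaryHeatSolution h t) ∧
      weightedSobolevNorm (Ioi 0) s m (boundaryHeatSolution h t) ≤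
        C * |Real.log (2 + t) / (2 + t)| ^
          ((1 : ℝ) / 4 + (2 * (n : ℝ) + 1) / 2 - (m : ℝ) / 2) := by
  choose D hD0 hD using exists_heatPotential_decay hT n hh hmom
  obtain ⟨K, hK, hmain⟩ := exists_weightedSobolevNorm_le s m (fun α => 2 * D α)
    fun α => mul_nonneg two_pos.le (hD0 α)
  set e : ℝ := (1 : ℝ) / 4 + (2 * (n : ℝ) + 1) / 2 - (m : ℝ) / 2 with he
  have he0 : 0 ≤ e := by
    have : (m : ℝ) ≤ 2 * n + 1 := by exact_mod_cast hm
    linarith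
  have hlog2 : 0 < Real.log 2 := Real.log_pos (by norm_num)
  refine ⟨Real.sqrt K / Real.log 2 ^ e, fun t ht => ?_⟩
  have hL : (0 : ℝ) < 2 + t := by linarith
  obtain ⟨h1, h2⟩ := hmain (2 + t) (by linarith) ((2 + t) ^ (n + 1))⁻¹ (by positivity)
    (boundaryHeatSolution h t) (fun j z => -2 * heatPotential (j + 1) h t z)
    (fun z hz => boundaryHeatSolution_eq h t hz)
    (fun j z hz => (hasDerivAt_heatPotential hh (j + 1) t hz).const_mul (-2))
    (fun j z hz => by
      have := hD j t ht z hz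
      rw [abs_mul, abs_neg, abs_two, mul_assoc 2, mul_assoc 2]
      exact mul_le_mul_of_nonneg_left this two_pos.le)
  refine ⟨h1, h2.trans ?_⟩
  have hpow : Real.sqrt (K * ((2 + t) ^ (n + 1))⁻¹ ^ 2 * (2 + t) ^ m * Real.sqrt (2 + t)) =
      Real.sqrt K * (2 + t) ^ (-e) := by
    rw [mul_assoc, mul_assoc, Real.sqrt_mul hK]
    congr 1
    rw [Real.sqrt_eq_rpow, Real.sqrt_eq_rpow, ← Real.rpow_natCast (2 + t) (n + 1),
      ← Real.rpow_natCast (2 + t) m, ← Real.rpow_neg hL.le, ← Real.rpow_natCast _ 2,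
      ← Real.rpow_mul hL.le, ← Real.rpow_add hL, ← Real.rpow_add hL, ← Real.rpow_mul hL.le, he]
    congr 1
    push_cast
    ring
  rw [hpow, abs_of_nonneg (div_nonneg (Real.log_nonneg (by linarith)) hL.le),
    Real.div_rpow (Real.log_nonneg (by linarith)) hL.le, Real.rpow_neg hL.le]
  have hlog : Real.log 2 ^ e ≤ Real.log (2 + t) ^ e :=
    Real.rpow_le_rpow hlog2.le (Real.log_le_log two_pos (by linarith)) he0
  have hp : 0 < Real.log 2 ^ e := Real.rpow_pos_of_pos hlog2 e
  have hq : 0 < (2 + t) ^ e := Real.rpow_pos_of_pos hL e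
  calc Real.sqrt K * ((2 + t) ^ e)⁻¹ =
        Real.sqrt K / Real.log 2 ^ e * (Real.log 2 ^ e / (2 + t) ^ e) := by field_simp
    _ ≤ Real.sqrt K / Real.log 2 ^ e * (Real.log (2 + t) ^ e / (2 + t) ^ e) := by gcongr

end BoundaryLayer

theorem mainTheorem6 (T : ℝ) (hT : 0 < T) (s n : ℕ) (h : ℝ → ℝ) (h_smooth : ContDiff ℝ ∞ h)
    (h_supp : tsupport h ⊆ Set.Ioc 0 (T / 3) ∪ Set.Ico (2 * T / 3) T)
    (h_moments : ∀ k < n, ∫ t in (0 : ℝ)..T, t ^ k * h t = 0) :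
    ∃ V : ℝ → ℝ → ℝ, BoundaryLayer.IsHalfLineHeatSolution h V ∧
      (∀ W : ℝ → ℝ → ℝ, BoundaryLayer.IsHalfLineHeatSolution h W →
        ∀ t ≥ 0, ∀ z ≥ 0, W t z = V t z) ∧
      ∀ m : ℕ, m ≤ 2 * n + 1 → ∃ C : ℝ, ∀ t : ℝ, 0 ≤ t →
        BoundaryLayer.MemWeightedSobolev (Set.Ioi 0) s m (V t) ∧
        BoundaryLayer.weightedSobolevNorm (Set.Ioi 0) s m (V t) ≤
          C * |Real.log (2 + t) / (2 + t)| ^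
            ((1 : ℝ) / 4 + (2 * (n : ℝ) + 1) / 2 - (m : ℝ) / 2) := by
  have hh : BoundaryLayer.IsBoundaryDatum T h := ⟨h_smooth, fun x hx => by
    rcases h_supp hx with hx | hx
    · exact ⟨hx.1.le, by linarith [hx.2]⟩
    · exact ⟨by linarith [hx.1], hx.2.le⟩⟩
  have hV := BoundaryLayer.isHalfLineHeatSolution_boundaryHeatSolution hh
  exact ⟨BoundaryLayer.boundaryHeatSolution h, hV, fun W hW t ht z hz => hW.unique hV ht hz,
    fun m hm => BoundaryLayer.exists_sobolev_decay hT s n m hm hh h_moments⟩
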